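/- Let $0<\alpha<1$ and $\theta>-\alpha$. Let $H_1,H_2,\dots$ be independent random variables, $H_i$ having the $\mathrm{Beta}(1-\alpha,\theta+i\alpha)$ distribution, and put $Y_0=0$ and $Y_k=1-\prod_{i=1}^k(1-H_i)$ for $k\ge1$. Given $(Y_k)_{k\ge 1}$, let $X_1,X_2,\dots$ be independent and identically distributed positive integer valued random variables with $\mathbb P[X_1\le k\mid (Y_i)_{i\ge1}]=Y_k$ for every $k$ (a $\mathrm{GEM}(\alpha,\theta)$ exchangeable sequence), and let $M_n=\max\{X_1,\dots,X_n\}$. Then there is a probability distribution on $(0,\infty)$ with $p$-th moment $$\frac{\Gamma(\theta+1)}{\Gamma(\theta/\alpha+1)}\,\frac{\Gamma(p+\theta/\alpha+1)}{\Gamma(p\alpha+\theta+1)}\qquad\text{for every real }p>0,$$ it is the only probability distribution on $\mathbb R$ whose moments of all integer orders $p\ge 0$ are given by this formula, and, if $D_{\alpha,\theta}$ (the $\alpha$-diversity) denotes a random variable with this distribution, then for each $x>0$ $$\mathbb P\bigl[M_n\le x\,n^{\alpha/(1-\alpha)}\bigr]\;\longrightarrow\;\mathbb E\exp\bigl(-\alpha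 D_{\alpha,\theta}^{1/\alpha}x^{-(1-\alpha)/\alpha}\bigr)\qquad\text{as }n\to\infty .$$ -/

import Mathlib

open MeasureTheory ProbabilityTheory Filter Topology

noncomputable section

namespace GEM


/-- The cut points `Y_k = 1 - ∏_{i=1}^k (1 - H_i)`, with `Y_0 = 0`. The variable `H_i`, `i ≥ 1`,
is written `H (i - 1)`, that is, the sequence `H` is indexed from `0`. -/
def cutPoint {Ω : Type*} (H : ℕ → Ω → ℝ) (k : ℕ) (ω : Ω) : ℝ :=
  1 - ∏ i ∈ Finset.range k, (1 - H i ω)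

/-- The σ-algebra generated by the whole sequence of cut points. -/
abbrev cutPointSigma {Ω : Type*} (H : ℕ → Ω → ℝ) : MeasurableSpace Ω :=
  MeasurableSpace.comap (fun ω (k : ℕ) => cutPoint H k ω) inferInstance

/-- `X 0, X 1, …` is a GEM(`α`, `θ`) exchangeable sequence built from the hazard rates `H`:
the `H_i` are independent with law Beta(`1 - α`, `θ + i α`), and given the cut points `Y`
the `X j` are independent and identically distributed with `P[X j ≤ k | Y] = Y_k`
(for `k = 0` this says that `X j ≥ 1` almost surely). -/
structure IsExchangeableSample {Ω : Type*} [MeasurableSpace Ω] (α θ : ℝ) (P : Measure Ω)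
    (H : ℕ → Ω → ℝ) (X : ℕ → Ω → ℕ) : Prop where
  measurable_hazard : ∀ i, Measurable (H i)
  measurable_sample : ∀ j, Measurable (X j)
  indep_hazard : iIndepFun H P
  law_hazard : ∀ i : ℕ, P.map (H i) = betaMeasure (1 - α) (θ + ((i : ℝ) + 1) * α)
  cond_iid : ∀ (s : Finset ℕ) (k : ℕ → ℕ),
    P⟦{ω | ∀ j ∈ s, X j ω ≤ k j} | cutPointSigma H⟧
      =ᵐ[P] fun ω => ∏ j ∈ s, cutPoint H (k j) ω

/-- The maximum `M_n` of the first `n` terms of the sequence. -/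
def sampleMax {Ω : Type*} (X : ℕ → Ω → ℕ) (n : ℕ) (ω : Ω) : ℕ :=
  (Finset.range n).sup fun j => X j ω

/-- The `p`-th moment of the `α`-diversity. -/
def diversityMoment (α θ p : ℝ) : ℝ :=
  Real.Gamma (θ + 1) / Real.Gamma (θ / α + 1) *
    (Real.Gamma (p + θ / α + 1) / Real.Gamma (p * α + θ + 1))

end GEM

end

noncomputable section

namespace GEM

/-! Write `S_k` for the product of the first `k` factors `1 - H_i`. Given the cut points, `M_n ≤ k`
has probability `(1 - S_k)^n`. So everything rests on an almost sure limit `α^(-α) k^(1-α) S_k^α →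
D`: for `k ~ x n^(α/(1-α))` it gives `n S_k → α D^(1/α) x^(-(1-α)/α)`, and bounded convergence
finishes (`IsExchangeableSample.tendsto_sampleMax`).

The limit exists because `S_k^α` divided by its mean is a nonnegative martingale, and the mean is
explicit: raising the exponent of `S_k` by `α` turns each beta parameter into the next one, so a
product of Gamma quotients telescopes (`IsBetaHazard.integral_survival_rpow_add`). In the limit the
same telescoping relates the moments of `D` of orders `p + 1` and `p`. Since `p ↦ E D^p` is
log-convex, an argument in the style of Bohr–Mollerup (`eq_diversityMoment_of_logConvex`) shows that
this recursion and the value `1` at `0` determine every moment.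

These moments grow slowly enough for the characteristic function to be the sum of the moment series,
so they determine the law (`eq_of_moments_eq`). Hence `D` has the same law on whatever space it is
built. Letting `p → 0` in the moment formula shows `D > 0` almost surely. -/

/-! ### Gamma quotients, beta moments and convergence of expectations -/

theorem tendsto_Gamma_add_div_rpow {a : ℝ} (ha0 : 0 ≤ a) (ha1 : a ≤ 1) :
    Tendsto (fun x : ℝ => Real.Gamma (x + a) / (Real.Gamma x * x ^ a)) atTop (𝓝 1) := by
  rcases ha0.eq_or_lt with rfl | ha0
  · refine tendsto_const_nhds.congr' ?_
    filter_upwards [eventually_gt_atTop 0] with x hx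
    have := (Real.Gamma_pos_of_pos hx).ne'
    simp [this]
  rcases ha1.eq_or_lt with rfl | ha1
  · refine tendsto_const_nhds.congr' ?_
    filter_upwards [eventually_gt_atTop 0] with x hx
    have := (Real.Gamma_pos_of_pos hx).ne'
    rw [Real.Gamma_add_one hx.ne', Real.rpow_one]
    field_simp
  have hlow : Tendsto (fun x : ℝ => (x / (x + a)) ^ (1 - a)) atTop (𝓝 1) := by
    have h1 : Tendsto (fun x : ℝ => x / (x + a)) atTop (𝓝 1) := by
      have h2 : Tendsto (fun x : ℝ => 1 - a / (x + a)) atTop (𝓝 (1 - 0)) :=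
        tendsto_const_nhds.sub
          ((tendsto_atTop_add_const_right _ a tendsto_id).const_div_atTop a)
      rw [sub_zero] at h2
      refine h2.congr' ?_
      filter_upwards [eventually_gt_atTop 0] with x hx
      field_simp
      ring
    simpa using h1.rpow_const (p := 1 - a) (Or.inl one_ne_zero)
  refine tendsto_of_tendsto_of_tendsto_of_le_of_le' hlow tendsto_const_nhds ?_ ?_
  · filter_upwards [eventually_gt_atTop 0] with x hx
    have hxa : 0 < x + a := by linarith
    have hG := Real.Gamma_pos_of_pos hx
    have hGa := Real.Gamma_pos_of_pos hxa
    -- Lower bound: log-convexity of Gamma at `x + 1`, which lies between `x + a` and `x + a + 1`.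
    have h := Real.Gamma_mul_add_mul_le_rpow_Gamma_mul_rpow_Gamma hxa
      (by linarith : 0 < x + a + 1) ha0 (sub_pos.2 ha1) (by ring)
    rw [show a * (x + a) + (1 - a) * (x + a + 1) = x + 1 by ring,
      Real.Gamma_add_one hx.ne', Real.Gamma_add_one hxa.ne',
      Real.mul_rpow hxa.le hGa.le, mul_left_comm, ← Real.rpow_add hGa] at h
    simp only [add_sub_cancel, Real.rpow_one] at h
    rw [Real.div_rpow hx.le hxa.le, div_le_div_iff₀ (by positivity) (by positivity)]
    calc x ^ (1 - a) * (Real.Gamma x * x ^ a) = x ^ (1 - a) * x ^ a * Real.Gamma x := by ring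
      _ = x * Real.Gamma x := by rw [← Real.rpow_add hx]; simp
      _ ≤ _ := by linarith
  · filter_upwards [eventually_gt_atTop 0] with x hx
    have hG := Real.Gamma_pos_of_pos hx
    -- Upper bound: log-convexity at `x + a`, between `x` and `x + 1`.
    have h := Real.Gamma_mul_add_mul_le_rpow_Gamma_mul_rpow_Gamma hx
      (by linarith : 0 < x + 1) (sub_pos.2 ha1) ha0 (by ring)
    rw [show (1 - a) * x + a * (x + 1) = x + a by ring, Real.Gamma_add_one hx.ne',
      Real.mul_rpow hx.le hG.le, mul_left_comm, ← Real.rpow_add hG] at h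
    simp only [sub_add_cancel, Real.rpow_one] at h
    rw [div_le_one (by positivity)]
    linarith

theorem tendsto_Gamma_mul_add_div_rpow {a β : ℝ} (ha0 : 0 ≤ a) (ha1 : a ≤ 1) (hβ : 0 < β)
    (b : ℝ) :
    Tendsto (fun x : ℝ => Real.Gamma (β * x + b + a) / (Real.Gamma (β * x + b) * x ^ a)) atTop
      (𝓝 (β ^ a)) := by
  have hx : Tendsto (fun x : ℝ => β * x + b) atTop atTop :=
    tendsto_atTop_add_const_right _ _ (tendsto_id.const_mul_atTop hβ)
  have h1 := (tendsto_Gamma_add_div_rpow ha0 ha1).comp hx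
  have h2 : Tendsto (fun x : ℝ => (β * x + b) / x) atTop (𝓝 β) := by
    have h3 : Tendsto (fun x : ℝ => β + b / x) atTop (𝓝 (β + 0)) :=
      tendsto_const_nhds.add (tendsto_id.const_div_atTop b)
    rw [add_zero] at h3
    refine h3.congr' ?_
    filter_upwards [eventually_gt_atTop 0] with x hx
    field_simp
  have h4 := (h2.rpow_const (p := a) (Or.inr ha0)).mul h1
  rw [mul_one] at h4
  refine h4.congr' ?_
  filter_upwards [hx.eventually_gt_atTop 0, eventually_gt_atTop 0] with x hx hx0
  have hG := Real.Gamma_pos_of_pos hx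
  have hp := Real.rpow_pos_of_pos hx a
  have hp' := Real.rpow_pos_of_pos hx0 a
  simp only [Function.comp]
  rw [Real.div_rpow hx.le hx0.le]
  generalize (β * x + b) ^ a = y at hp ⊢
  field_simp

/-- The moments of `1 - B` where `B` is beta distributed. -/
theorem lintegral_one_sub_rpow_betaMeasure {a b p : ℝ} (ha : 0 < a) (hb : 0 < b)
    (hp : 0 < b + p) :
    ∫⁻ x, ENNReal.ofReal (|1 - x| ^ p) ∂(betaMeasure a b) =
      ENNReal.ofReal (Real.Gamma (b + p) * Real.Gamma (a + b) /
        (Real.Gamma b * Real.Gamma (a + b + p))) := by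
  have hab := Real.Gamma_pos_of_pos (add_pos ha hb)
  have habp := Real.Gamma_pos_of_pos (add_pos ha hp)
  have hG1 := Real.Gamma_pos_of_pos ha
  have hG2 := Real.Gamma_pos_of_pos hb
  have hG3 := Real.Gamma_pos_of_pos hp
  rw [← add_assoc] at habp
  have hm : Measurable (betaPDF a b) := (measurable_betaPDFReal a b).ennreal_ofReal
  have hm' : Measurable (betaPDF a (b + p)) := (measurable_betaPDFReal a (b + p)).ennreal_ofReal
  rw [betaMeasure, lintegral_withDensity_eq_lintegral_mul _ hm (by fun_prop)]
  set c := Real.Gamma (b + p) * Real.Gamma (a + b) / (Real.Gamma b * Real.Gamma (a + b + p)) with hc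
  have hc0 : 0 ≤ c := by positivity
  have : ∀ x, (betaPDF a b * fun x : ℝ => ENNReal.ofReal (|1 - x| ^ p)) x =
      ENNReal.ofReal c * betaPDF a (b + p) x := by
    intro x
    simp only [Pi.mul_apply, betaPDF_eq]
    split_ifs with h
    · have h1 : 0 < 1 - x := by linarith [h.2]
      rw [← ENNReal.ofReal_mul' (Real.rpow_nonneg (abs_nonneg _) _), ← ENNReal.ofReal_mul hc0, abs_of_pos h1,
        show b + p - 1 = (b - 1) + p by ring, Real.rpow_add h1]
      congr 1
      simp only [beta, hc, ← add_assoc]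
      field_simp
    · simp
  simp_rw [this]
  rw [lintegral_const_mul _ hm', lintegral_betaPDF_eq_one ha hp, mul_one]

theorem betaMeasure_ae_mem_Ioo (a b : ℝ) : ∀ᵐ x ∂(betaMeasure a b), x ∈ Set.Ioo (0 : ℝ) 1 := by
  have hm : Measurable (betaPDF a b) := (measurable_betaPDFReal a b).ennreal_ofReal
  rw [betaMeasure, ae_withDensity_iff hm]
  refine Eventually.of_forall fun x hx => ?_
  by_contra h
  rw [Set.mem_Ioo] at h
  simp [betaPDF_eq, h] at hx

/-- Convergence of expectations under a second moment bound. -/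
theorem tendsto_integral_of_sq_bound {Ω : Type*} [MeasurableSpace Ω] {P : Measure Ω}
    [IsProbabilityMeasure P] {f : ℕ → Ω → ℝ} {g : Ω → ℝ} {C : ℝ}
    (hfm : ∀ n, Measurable (f n)) (hf0 : ∀ n ω, 0 ≤ f n ω)
    (hi : ∀ n, Integrable (f n) P)
    (hi2 : ∀ n, Integrable (fun ω => f n ω ^ 2) P) (hC : ∀ n, ∫ ω, f n ω ^ 2 ∂P ≤ C)
    (hlim : ∀ᵐ ω ∂P, Tendsto (fun n => f n ω) atTop (𝓝 (g ω))) :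
    Integrable g P ∧ Tendsto (fun n => ∫ ω, f n ω ∂P) atTop (𝓝 (∫ ω, g ω ∂P)) := by
  have hui : UniformIntegrable f 1 P := by
    refine uniformIntegrable_of le_rfl ENNReal.one_ne_top
      (fun n => (hfm n).aestronglyMeasurable) fun ε hε => ?_
    have hC0 : 0 ≤ C := (integral_nonneg fun ω => sq_nonneg (f 0 ω)).trans (hC 0)
    -- Where `f n ≥ K` one has `f n ≤ (f n)^2 / K`, so the tail expectation is at most `C / K ≤ ε`.
    -- The `+ 1` keeps `K` positive when `C = 0`.
    set K : ℝ := (C + 1) / ε with hK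
    have hKpos : 0 < K := by positivity
    refine ⟨K.toNNReal, fun n => ?_⟩
    rw [eLpNorm_one_eq_lintegral_enorm]
    have hle : ∀ ω, ‖Set.indicator {x | K.toNNReal ≤ ‖f n x‖₊} (f n) ω‖ₑ ≤
        ENNReal.ofReal (f n ω ^ 2 / K) := by
      intro ω
      by_cases h : ω ∈ {x | K.toNNReal ≤ ‖f n x‖₊}
      · rw [Set.indicator_of_mem h, Real.enorm_eq_ofReal (hf0 n ω)]
        refine ENNReal.ofReal_le_ofReal ?_
        have h' : K ≤ f n ω := by
          have : (K.toNNReal : ℝ) ≤ ‖f n ω‖ := by exact_mod_cast h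
          rwa [Real.coe_toNNReal _ hKpos.le, Real.norm_of_nonneg (hf0 n ω)] at this
        rw [le_div_iff₀ hKpos]
        nlinarith [hf0 n ω]
      · rw [Set.indicator_of_notMem h]; simp
    refine (lintegral_mono hle).trans ?_
    rw [← ofReal_integral_eq_lintegral_ofReal ((hi2 n).div_const K)
      (Eventually.of_forall fun ω => by positivity), integral_div]
    refine ENNReal.ofReal_le_ofReal ?_
    rw [div_le_iff₀ hKpos, hK, mul_div_cancel₀ _ hε.ne']
    linarith [hC n]
  have hg : MemLp g 1 P := hui.memLp_of_ae_tendsto hlim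
  refine ⟨memLp_one_iff_integrable.1 hg, ?_⟩
  have := tendsto_Lp_finite_of_tendsto_ae le_rfl ENNReal.one_ne_top
    (fun n => (hfm n).aestronglyMeasurable) hg hui.unifIntegrable hlim
  refine tendsto_integral_of_L1' g (memLp_one_iff_integrable.1 hg).aestronglyMeasurable (Eventually.of_forall hi) this

/-! ### Survival probabilities and their moments -/

/-- Independent hazard rates, `H i` having law Beta(`1 - α`, `θ + (i + 1) α`). -/
structure IsBetaHazard {Ω : Type*} [MeasurableSpace Ω] (α θ : ℝ) (P : Measure Ω)
    (H : ℕ → Ω → ℝ) : Prop where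
  measurable : ∀ i, Measurable (H i)
  indep : iIndepFun H P
  law : ∀ i : ℕ, P.map (H i) = betaMeasure (1 - α) (θ + ((i : ℝ) + 1) * α)

/-- The survival probability `∏_{i < k} |1 - H i|`; the absolute value only matters on a null set. -/
def survival {Ω : Type*} (H : ℕ → Ω → ℝ) (k : ℕ) (ω : Ω) : ℝ :=
  ∏ i ∈ Finset.range k, |1 - H i ω|

theorem survival_nonneg {Ω : Type*} (H : ℕ → Ω → ℝ) (k : ℕ) (ω : Ω) : 0 ≤ survival H k ω :=
  Finset.prod_nonneg fun _ _ => abs_nonneg _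

/-- The factor `Γ(θ + (k+1)α + q) / Γ(θ + kα + 1 + q)` whose increments telescope. -/
def gammaQuotient (α θ q : ℝ) (k : ℕ) : ℝ :=
  Real.Gamma (θ + ((k : ℝ) + 1) * α + q) / Real.Gamma (θ + ((k : ℝ) + 1) * α + q + (1 - α))

theorem tendsto_gammaQuotient {α : ℝ} (θ q : ℝ) (hα0 : 0 < α) (hα1 : α < 1) :
    Tendsto (fun k : ℕ => (k : ℝ) ^ (1 - α) * gammaQuotient α θ q k) atTop
      (𝓝 (α ^ (-(1 - α)))) := by
  have h := ((tendsto_Gamma_mul_add_div_rpow (sub_nonneg.2 hα1.le)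
    (by linarith : 1 - α ≤ 1) hα0 (θ + α + q)).comp tendsto_natCast_atTop_atTop).inv₀
    (Real.rpow_pos_of_pos hα0 _).ne'
  rw [← Real.rpow_neg hα0.le] at h
  refine h.congr fun k => ?_
  simp only [Function.comp, gammaQuotient, inv_div]
  rw [show θ + ((k : ℝ) + 1) * α + q = α * k + (θ + α + q) by ring]
  ring

/-- The quotient of the moments of the `α`-diversity of orders `p + 1` and `p`. -/
def momentRatio (α θ p : ℝ) : ℝ :=
  Real.Gamma (p * α + θ + 1) / (α * Real.Gamma (p * α + θ + α))

section

variable {Ω : Type*} [MeasurableSpace Ω] {P : Measure Ω} {α θ : ℝ} {H : ℕ → Ω → ℝ}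

theorem IsBetaHazard.shape_pos (hα0 : 0 < α) (hθ : -α < θ) (i : ℕ) :
    0 < θ + ((i : ℝ) + 1) * α := by
  have : 0 ≤ (i : ℝ) * α := by positivity
  linarith

theorem IsBetaHazard.ae_mem_Ioo (h : IsBetaHazard α θ P H) :
    ∀ᵐ ω ∂P, ∀ i, H i ω ∈ Set.Ioo (0 : ℝ) 1 := by
  rw [ae_all_iff]
  intro i
  have := betaMeasure_ae_mem_Ioo (1 - α) (θ + ((i : ℝ) + 1) * α)
  rw [← h.law i] at this
  exact ae_of_ae_map (h.measurable i).aemeasurable this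

theorem IsBetaHazard.measurable_survival (h : IsBetaHazard α θ P H) (k : ℕ) :
    Measurable (survival H k) :=
  Finset.measurable_fun_prod _ fun i _ => ((h.measurable i).const_sub 1).abs

theorem IsBetaHazard.ae_survival (h : IsBetaHazard α θ P H) :
    ∀ᵐ ω ∂P, ∀ k, 0 < survival H k ω ∧ survival H k ω ≤ 1 ∧
      cutPoint H k ω = 1 - survival H k ω := by
  filter_upwards [h.ae_mem_Ioo] with ω hω k
  have h0 : ∀ i, |1 - H i ω| = 1 - H i ω := fun i => abs_of_pos (by linarith [(hω i).2])
  simp only [survival, cutPoint, h0]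
  exact ⟨Finset.prod_pos fun i _ => by linarith [(hω i).2],
    Finset.prod_le_one (fun i _ => by linarith [(hω i).2]) fun i _ => by linarith [(hω i).1],
    trivial⟩

theorem IsBetaHazard.integrable_survival_rpow [IsProbabilityMeasure P]
    (h : IsBetaHazard α θ P H) (k : ℕ) {p : ℝ} (hp : 0 ≤ p) :
    Integrable (fun ω => survival H k ω ^ p) P := by
  refine Integrable.of_bound ((h.measurable_survival k).pow_const p).aestronglyMeasurable 1 ?_
  filter_upwards [h.ae_survival] with ω hω
  rw [Real.norm_of_nonneg (Real.rpow_nonneg (survival_nonneg H k ω) p)]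
  exact Real.rpow_le_one (survival_nonneg H k ω) (hω k).2.1 hp

theorem IsBetaHazard.integral_rpow (h : IsBetaHazard α θ P H) (hα0 : 0 < α) (hα1 : α < 1)
    (hθ : -α < θ) (i : ℕ) {p : ℝ} (hp : 0 ≤ p) :
    ∫ ω, |1 - H i ω| ^ p ∂P =
      Real.Gamma (θ + ((i : ℝ) + 1) * α + p) * Real.Gamma (1 - α + (θ + ((i : ℝ) + 1) * α)) /
        (Real.Gamma (θ + ((i : ℝ) + 1) * α) *
          Real.Gamma (1 - α + (θ + ((i : ℝ) + 1) * α) + p)) := by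
  have ha := shape_pos hα0 hθ i
  have hmeas : Measurable fun x : ℝ => |1 - x| ^ p := by fun_prop
  rw [← integral_map (f := fun x : ℝ => |1 - x| ^ p) (h.measurable i).aemeasurable
    hmeas.aestronglyMeasurable, h.law i,
    integral_eq_lintegral_of_nonneg_ae (Eventually.of_forall fun x => by positivity)
      hmeas.aestronglyMeasurable,
    lintegral_one_sub_rpow_betaMeasure (by linarith) ha (by linarith), ENNReal.toReal_ofReal]
  have := Real.Gamma_pos_of_pos ha
  have := Real.Gamma_pos_of_pos (show 0 < θ + ((i : ℝ) + 1) * α + p by linarith)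
  have := Real.Gamma_pos_of_pos (show 0 < 1 - α + (θ + ((i : ℝ) + 1) * α) by linarith)
  have := Real.Gamma_pos_of_pos (show 0 < 1 - α + (θ + ((i : ℝ) + 1) * α) + p by linarith)
  positivity

theorem IsBetaHazard.integral_survival_rpow (h : IsBetaHazard α θ P H) (k : ℕ) (p : ℝ) :
    ∫ ω, survival H k ω ^ p ∂P = ∏ i ∈ Finset.range k, ∫ ω, |1 - H i ω| ^ p ∂P := by
  have hmeas : Measurable fun x : ℝ => |1 - x| ^ p := by fun_prop
  have hi : iIndepFun (fun i : Fin k => H i) P := h.indep.precomp Fin.val_injective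
  have := hi.integral_fun_prod_comp (f := fun _ x => |1 - x| ^ p)
    (fun i => (h.measurable i).aemeasurable) (fun i => hmeas.aestronglyMeasurable)
  rw [Finset.prod_range, ← this]
  refine integral_congr_ae (Eventually.of_forall fun ω => ?_)
  simp only [survival]
  rw [← Real.finsetProd_rpow _ _ fun i _ => abs_nonneg _, Finset.prod_range]

/-- The second beta parameters increase by exactly `α` from one index to the next. So in the ratio
of the moments of `1 - H i` of orders `q + α` and `q`, the factors free of the order cancel and what
remains is `gammaQuotient` at `i + 1` over `gammaQuotient` at `i`; the product telescopes. -/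
theorem IsBetaHazard.integral_survival_rpow_add (h : IsBetaHazard α θ P H) (hα0 : 0 < α)
    (hα1 : α < 1) (hθ : -α < θ) (k : ℕ) {q : ℝ} (hq : 0 ≤ q) :
    ∫ ω, survival H k ω ^ (q + α) ∂P =
      (∫ ω, survival H k ω ^ q ∂P) * (gammaQuotient α θ q k / gammaQuotient α θ q 0) := by
  have hpos : ∀ i : ℕ, 0 < gammaQuotient α θ q i := fun i => by
    have := shape_pos hα0 hθ i
    exact div_pos (Real.Gamma_pos_of_pos (by linarith)) (Real.Gamma_pos_of_pos (by linarith))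
  have htel : ∏ i ∈ Finset.range k, gammaQuotient α θ q (i + 1) / gammaQuotient α θ q i =
      gammaQuotient α θ q k / gammaQuotient α θ q 0 := by
    induction k with
    | zero => simp [(hpos 0).ne']
    | succ k ih =>
      rw [Finset.prod_range_succ, ih, div_mul_div_cancel₀' (hpos k).ne']
  rw [h.integral_survival_rpow, h.integral_survival_rpow, ← htel, ← Finset.prod_mul_distrib]
  refine Finset.prod_congr rfl fun i _ => ?_
  have ha := shape_pos hα0 hθ i
  rw [h.integral_rpow hα0 hα1 hθ i hq, h.integral_rpow hα0 hα1 hθ i (by linarith)]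
  have h1 := Real.Gamma_pos_of_pos ha
  have h2 := Real.Gamma_pos_of_pos (show 0 < θ + ((i : ℝ) + 1) * α + q by linarith)
  have h3 := Real.Gamma_pos_of_pos (show 0 < θ + ((i : ℝ) + 1) * α + q + α by linarith)
  have h4 := Real.Gamma_pos_of_pos (show 0 < 1 - α + (θ + ((i : ℝ) + 1) * α) by linarith)
  have h5 := Real.Gamma_pos_of_pos (show 0 < 1 - α + (θ + ((i : ℝ) + 1) * α) + q by linarith)
  have h6 := Real.Gamma_pos_of_pos
    (show 0 < 1 - α + (θ + ((i : ℝ) + 1) * α) + (q + α) by linarith)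
  simp only [gammaQuotient]
  push_cast
  rw [show θ + ((i : ℝ) + 1 + 1) * α + q = θ + ((i : ℝ) + 1) * α + q + α by ring,
    show θ + ((i : ℝ) + 1) * α + q + α + (1 - α) =
      1 - α + (θ + ((i : ℝ) + 1) * α) + (q + α) by ring,
    show θ + ((i : ℝ) + 1) * α + q + (1 - α) = 1 - α + (θ + ((i : ℝ) + 1) * α) + q by ring,
    ← add_assoc (θ + ((i : ℝ) + 1) * α) q α]
  field_simp

end

/-- The rescaled survival probability, which converges to the `α`-diversity. -/
def scaledSurvival {Ω : Type*} (α : ℝ) (H : ℕ → Ω → ℝ) (k : ℕ) (ω : Ω) : ℝ :=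
  α ^ (-α) * (k : ℝ) ^ (1 - α) * survival H k ω ^ α

theorem scaledSurvival_nonneg {Ω : Type*} {α : ℝ} (hα0 : 0 < α) (H : ℕ → Ω → ℝ) (k : ℕ) (ω : Ω) :
    0 ≤ scaledSurvival α H k ω :=
  mul_nonneg (by positivity) (Real.rpow_nonneg (survival_nonneg H k ω) _)

theorem scaledSurvival_rpow {Ω : Type*} {α : ℝ} (hα0 : 0 < α) (H : ℕ → Ω → ℝ) (k : ℕ) (p : ℝ) (ω : Ω) :
    scaledSurvival α H k ω ^ p =
      (α ^ (-α) * (k : ℝ) ^ (1 - α)) ^ p * survival H k ω ^ (p * α) := by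
  rw [scaledSurvival, Real.mul_rpow (by positivity) (Real.rpow_nonneg (survival_nonneg H k ω) _),
    ← Real.rpow_mul (survival_nonneg H k ω), mul_comm α p]

section

variable {Ω : Type*} [MeasurableSpace Ω] {P : Measure Ω} {α θ : ℝ} {H : ℕ → Ω → ℝ}

theorem IsBetaHazard.measurable_scaledSurvival (h : IsBetaHazard α θ P H) (k : ℕ) :
    Measurable (scaledSurvival α H k) :=
  ((h.measurable_survival k).pow_const α).const_mul _

theorem IsBetaHazard.integrable_scaledSurvival_rpow [IsProbabilityMeasure P]
    (h : IsBetaHazard α θ P H) (hα0 : 0 < α) (k : ℕ) {p : ℝ} (hp : 0 ≤ p) :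
    Integrable (fun ω => scaledSurvival α H k ω ^ p) P := by
  simp_rw [scaledSurvival_rpow hα0]
  exact (h.integrable_survival_rpow k (by positivity)).const_mul _

/-- One more power of the scaled variable costs `α` more in the exponent of `survival`, which is the
shift that telescopes. -/
theorem IsBetaHazard.integral_scaledSurvival_rpow_add_one (h : IsBetaHazard α θ P H)
    (hα0 : 0 < α) (hα1 : α < 1) (hθ : -α < θ) (k : ℕ) {p : ℝ} (hp : 0 ≤ p) :
    ∫ ω, scaledSurvival α H k ω ^ (p + 1) ∂P = (∫ ω, scaledSurvival α H k ω ^ p ∂P) *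
      (α ^ (-α) * ((k : ℝ) ^ (1 - α) * gammaQuotient α θ (p * α) k) /
        gammaQuotient α θ (p * α) 0) := by
  simp_rw [scaledSurvival_rpow hα0]
  rw [integral_const_mul, integral_const_mul, add_mul, one_mul,
    h.integral_survival_rpow_add hα0 hα1 hθ k (by positivity),
    Real.rpow_add_one' (by positivity) (by positivity)]
  ring

theorem tendsto_momentRatio (hα0 : 0 < α) (hα1 : α < 1) (θ p : ℝ) :
    Tendsto (fun k : ℕ => α ^ (-α) * ((k : ℝ) ^ (1 - α) * gammaQuotient α θ (p * α) k) /
        gammaQuotient α θ (p * α) 0) atTop (𝓝 (momentRatio α θ p)) := by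
  have := ((tendsto_gammaQuotient θ (p * α) hα0 hα1).const_mul (α ^ (-α))).div_const
    (gammaQuotient α θ (p * α) 0)
  convert this using 2
  rw [← Real.rpow_add hα0, momentRatio, gammaQuotient]
  simp only [Nat.cast_zero, zero_add, one_mul]
  rw [show -α + -(1 - α) = -1 by ring, Real.rpow_neg_one,
    show θ + α + p * α = p * α + θ + α by ring,
    show p * α + θ + α + (1 - α) = p * α + θ + 1 by ring, div_div_eq_mul_div, mul_comm α,
    ← div_div, div_eq_mul_inv _ α]
  ring

/-- For integer orders, induction: the factor of the recursion converges in `k`, hence is bounded.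
Other orders follow from `t^p ≤ 1 + t^m` with an integer `m ≥ p`. -/
theorem IsBetaHazard.exists_integral_le [IsProbabilityMeasure P] (h : IsBetaHazard α θ P H)
    (hα0 : 0 < α) (hα1 : α < 1) (hθ : -α < θ) {p : ℝ} (hp : 0 ≤ p) :
    ∃ C, ∀ k, ∫ ω, scaledSurvival α H k ω ^ p ∂P ≤ C := by
  have hnat : ∀ m : ℕ, ∃ C, ∀ k, ∫ ω, scaledSurvival α H k ω ^ (m : ℝ) ∂P ≤ C := by
    intro m
    induction m with
    | zero => exact ⟨1, fun k => by simp⟩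
    | succ m ih =>
      obtain ⟨C, hC⟩ := ih
      obtain ⟨R, hR⟩ := (tendsto_momentRatio hα0 hα1 θ (m : ℝ)).bddAbove_range
      have hR' := fun k : ℕ => hR (Set.mem_range_self k)
      refine ⟨C * max R 0, fun k => ?_⟩
      push_cast
      rw [h.integral_scaledSurvival_rpow_add_one hα0 hα1 hθ k (Nat.cast_nonneg m)]
      have h0 : 0 ≤ ∫ ω, scaledSurvival α H k ω ^ (m : ℝ) ∂P :=
        integral_nonneg fun ω => Real.rpow_nonneg (scaledSurvival_nonneg hα0 H k ω) _
      exact (mul_le_mul_of_nonneg_left ((hR' k).trans (le_max_left _ _)) h0).trans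
        (mul_le_mul_of_nonneg_right (hC k) (le_max_right _ _))
  obtain ⟨m, hm⟩ := exists_nat_ge p
  obtain ⟨C, hC⟩ := hnat m
  refine ⟨1 + C, fun k => ?_⟩
  have hi := h.integrable_scaledSurvival_rpow hα0 k (Nat.cast_nonneg (α := ℝ) m)
  calc ∫ ω, scaledSurvival α H k ω ^ p ∂P
      ≤ ∫ ω, (1 + scaledSurvival α H k ω ^ (m : ℝ)) ∂P := by
        refine integral_mono (h.integrable_scaledSurvival_rpow hα0 k hp)
          ((integrable_const 1).add hi) fun ω => ?_
        have h0 := scaledSurvival_nonneg hα0 H k ω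
        rcases le_total (scaledSurvival α H k ω) 1 with h1 | h1
        · have := Real.rpow_le_one h0 h1 hp
          have := Real.rpow_nonneg h0 (m : ℝ)
          simp only; linarith
        · have := Real.rpow_le_rpow_of_exponent_le h1 hm
          simp only; linarith
    _ = 1 + ∫ ω, scaledSurvival α H k ω ^ (m : ℝ) ∂P := by
        rw [integral_add (integrable_const 1) hi]; simp
    _ ≤ 1 + C := by linarith [hC k]

end

/-! ### The almost sure limit and its moment recursion -/

/-- Products of independent nonnegative variables with mean one converge almost surely. -/
theorem ae_exists_tendsto_prod {Ω : Type*} [MeasurableSpace Ω] {P : Measure Ω}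
    [IsProbabilityMeasure P] {ξ : ℕ → Ω → ℝ} (hm : ∀ i, Measurable (ξ i))
    (h0 : ∀ i ω, 0 ≤ ξ i ω) (hi : ∀ i, Integrable (ξ i) P) (h1 : ∀ i, ∫ ω, ξ i ω ∂P = 1)
    (hind : iIndepFun ξ P) :
    ∀ᵐ ω ∂P, ∃ c, Tendsto (fun n => ∏ i ∈ Finset.range n, ξ i ω) atTop (𝓝 c) := by
  have hsm : ∀ i, StronglyMeasurable (ξ i) := fun i => (hm i).stronglyMeasurable
  have hindn : ∀ n, IndepFun (∏ j ∈ Finset.range n, ξ j) (ξ n) P := fun n =>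
    hind.indepFun_prod_range_succ hm n
  have hint : ∀ n, Integrable (∏ j ∈ Finset.range n, ξ j) P ∧
      ∫ ω, (∏ j ∈ Finset.range n, ξ j) ω ∂P = 1 := by
    intro n
    induction n with
    | zero => exact ⟨integrable_const (μ := P) (1 : ℝ), by simp⟩
    | succ n ih =>
      rw [Finset.prod_range_succ]
      refine ⟨(hindn n).integrable_mul ih.1 (hi n), ?_⟩
      rw [(hindn n).integral_mul_eq_mul_integral ih.1.aestronglyMeasurable
        (hi n).aestronglyMeasurable, ih.2, h1, one_mul]
  -- The product has `n + 1` factors because the natural filtration at time `n` already contains `ξ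
  -- n`.
  have hmart : Martingale (fun n => ∏ j ∈ Finset.range (n + 1), ξ j)
      (Filtration.natural ξ hsm) P := by
    have hadp : ∀ n, StronglyMeasurable[Filtration.natural ξ hsm n]
        (∏ j ∈ Finset.range (n + 1), ξ j) := fun n =>
      Finset.stronglyMeasurable_prod _ fun j hj =>
        (Filtration.stronglyAdapted_natural hsm j).mono
          ((Filtration.natural ξ hsm).mono (Nat.lt_succ_iff.1 (Finset.mem_range.1 hj)))
    refine martingale_nat hadp (fun n => (hint (n + 1)).1) fun n => ?_
    have hce : P[ξ (n + 1) | Filtration.natural ξ hsm n] =ᵐ[P] fun _ => P[ξ (n + 1)] :=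
      condExp_indep_eq (hm (n + 1)).comap_le ((Filtration.natural ξ hsm).le n)
        (comap_measurable (ξ (n + 1))).stronglyMeasurable
        (hind.indep_comap_natural_of_lt hsm (Nat.lt_succ_self n))
    have hpull := condExp_mul_of_stronglyMeasurable_left (hadp n)
      (by rw [← Finset.prod_range_succ]; exact (hint (n + 1 + 1)).1) (hi (n + 1))
    rw [← Finset.prod_range_succ] at hpull
    filter_upwards [hce, hpull] with ω h2 h3
    rw [h3, Pi.mul_apply, h2, h1, mul_one]
  -- Nonnegativity and mean one make every `L¹` norm equal to `1`, as Doob's convergence theorem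
  -- needs.
  have hconv := hmart.submartingale.exists_ae_tendsto_of_bdd (R := 1) fun n => by
    rw [eLpNorm_one_eq_lintegral_enorm]
    have h00 : ∀ ω, 0 ≤ (∏ j ∈ Finset.range (n + 1), ξ j) ω := fun ω => by
      rw [Finset.prod_apply]; exact Finset.prod_nonneg fun j _ => h0 j ω
    simp_rw [fun ω => Real.enorm_eq_ofReal (h00 ω)]
    rw [← ofReal_integral_eq_lintegral_ofReal (hint (n + 1)).1 (Eventually.of_forall h00),
      (hint (n + 1)).2]
    simp
  filter_upwards [hconv] with ω ⟨c, hc⟩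
  refine ⟨c, (tendsto_add_atTop_iff_nat 1).1 ?_⟩
  simpa only [Finset.prod_apply] using hc

section

variable {Ω : Type*} [MeasurableSpace Ω] {P : Measure Ω} {α θ : ℝ} {H : ℕ → Ω → ℝ}

/-- The normalized factors `|1 - H i|^α / c i` have mean one, so their products converge. The
product of the `c i` is known from the telescoping identity at `q = 0`, and the remaining
deterministic factor tends to `momentRatio α θ 0`. -/
theorem IsBetaHazard.exists_limit [IsProbabilityMeasure P] (h : IsBetaHazard α θ P H)
    (hα0 : 0 < α) (hα1 : α < 1) (hθ : -α < θ) :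
    ∃ D : Ω → ℝ, Measurable D ∧ (∀ ω, 0 ≤ D ω) ∧
      ∀ᵐ ω ∂P, Tendsto (fun k => scaledSurvival α H k ω) atTop (𝓝 (D ω)) := by
  set c : ℕ → ℝ := fun i => ∫ ω, |1 - H i ω| ^ α ∂P with hc
  have hcpos : ∀ i, 0 < c i := fun i => by
    have ha := shape_pos hα0 hθ i
    rw [hc]
    simp only
    rw [h.integral_rpow hα0 hα1 hθ i hα0.le]
    have h1 := Real.Gamma_pos_of_pos ha
    have h2 := Real.Gamma_pos_of_pos (show 0 < θ + ((i : ℝ) + 1) * α + α by linarith)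
    have h3 := Real.Gamma_pos_of_pos (show 0 < 1 - α + (θ + ((i : ℝ) + 1) * α) by linarith)
    have h4 := Real.Gamma_pos_of_pos (show 0 < 1 - α + (θ + ((i : ℝ) + 1) * α) + α by linarith)
    positivity
  have hmeas : ∀ i, Measurable fun x : ℝ => |1 - x| ^ α / c i := fun i => by fun_prop
  -- A non-integrable function would have integral `0` by convention, against `hcpos`.
  have hint : ∀ i, Integrable (fun ω => |1 - H i ω| ^ α) P := fun i =>
    by_contra fun hn => (hcpos i).ne' (integral_undef hn)
  have hconv := ae_exists_tendsto_prod (P := P) (ξ := fun i ω => |1 - H i ω| ^ α / c i)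
    (fun i => (hmeas i).comp (h.measurable i))
    (fun i ω => div_nonneg (by positivity) (hcpos i).le)
    (fun i => (hint i).div_const _)
    (fun i => by rw [integral_div]; exact div_self (hcpos i).ne')
    (h.indep.comp _ hmeas)
  have hprod : ∀ k ω, scaledSurvival α H k ω =
      (α ^ (-α) * ((k : ℝ) ^ (1 - α) * gammaQuotient α θ (0 * α) k) /
        gammaQuotient α θ (0 * α) 0) * ∏ i ∈ Finset.range k, |1 - H i ω| ^ α / c i := by
    intro k ω
    have h1 := h.integral_survival_rpow_add hα0 hα1 hθ k le_rfl
    simp only [zero_add, Real.rpow_zero, integral_const, probReal_univ, smul_eq_mul, one_mul,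
      mul_one] at h1
    rw [h.integral_survival_rpow] at h1
    change ∏ i ∈ Finset.range k, c i = _ at h1
    have h2 : (0 : ℝ) < ∏ i ∈ Finset.range k, c i := Finset.prod_pos fun i _ => hcpos i
    rw [Finset.prod_div_distrib, Real.finsetProd_rpow _ _ fun i _ => abs_nonneg _, zero_mul,
      ← mul_assoc, mul_div_assoc, ← h1, scaledSurvival, survival]
    field_simp
  have hlim : ∀ᵐ ω ∂P, ∃ l, Tendsto (fun k => scaledSurvival α H k ω) atTop (𝓝 l) := by
    filter_upwards [hconv] with ω ⟨l, hl⟩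
    exact ⟨_, ((tendsto_momentRatio hα0 hα1 θ 0).mul hl).congr fun k => (hprod k ω).symm⟩
  obtain ⟨D, hD, hDlim⟩ := measurable_limit_of_tendsto_metrizable_ae
    (fun k => (h.measurable_scaledSurvival k).aemeasurable) hlim
  -- The maximum with `0` makes nonnegativity hold everywhere and changes nothing almost surely.
  refine ⟨fun ω => max (D ω) 0, hD.max measurable_const, fun ω => le_max_right _ _, ?_⟩
  filter_upwards [hDlim] with ω hω
  rwa [max_eq_left (ge_of_tendsto' hω fun k => scaledSurvival_nonneg hα0 H k ω)]

/-- The moments of order `2p` are bounded in `k`, which gives uniform integrability of the `p`-th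
powers. -/
theorem IsBetaHazard.tendsto_integral_rpow [IsProbabilityMeasure P] (h : IsBetaHazard α θ P H)
    (hα0 : 0 < α) (hα1 : α < 1) (hθ : -α < θ) {D : Ω → ℝ}
    (hD : ∀ᵐ ω ∂P, Tendsto (fun k => scaledSurvival α H k ω) atTop (𝓝 (D ω)))
    {p : ℝ} (hp : 0 ≤ p) :
    Integrable (fun ω => D ω ^ p) P ∧
      Tendsto (fun k => ∫ ω, scaledSurvival α H k ω ^ p ∂P) atTop (𝓝 (∫ ω, D ω ^ p ∂P)) := by
  obtain ⟨C, hC⟩ := h.exists_integral_le hα0 hα1 hθ (p := p * 2) (by positivity)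
  have hsq : ∀ k ω, (scaledSurvival α H k ω ^ p) ^ 2 = scaledSurvival α H k ω ^ (p * 2) :=
    fun k ω => by
      rw [Real.rpow_mul (scaledSurvival_nonneg hα0 H k ω), Real.rpow_two]
  refine tendsto_integral_of_sq_bound (C := C)
    (fun k => (h.measurable_scaledSurvival k).pow_const p)
    (fun k ω => Real.rpow_nonneg (scaledSurvival_nonneg hα0 H k ω) p)
    (fun k => h.integrable_scaledSurvival_rpow hα0 k hp) (fun k => ?_) (fun k => ?_) ?_
  · simp_rw [hsq]
    exact h.integrable_scaledSurvival_rpow hα0 k (by positivity)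
  · simp_rw [hsq]
    exact hC k
  · filter_upwards [hD] with ω hω
    exact hω.rpow_const (Or.inr hp)

theorem IsBetaHazard.integral_limit_rpow_add_one [IsProbabilityMeasure P]
    (h : IsBetaHazard α θ P H) (hα0 : 0 < α) (hα1 : α < 1) (hθ : -α < θ) {D : Ω → ℝ}
    (hD : ∀ᵐ ω ∂P, Tendsto (fun k => scaledSurvival α H k ω) atTop (𝓝 (D ω)))
    {p : ℝ} (hp : 0 ≤ p) :
    ∫ ω, D ω ^ (p + 1) ∂P = (∫ ω, D ω ^ p ∂P) * momentRatio α θ p := by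
  refine tendsto_nhds_unique
    (h.tendsto_integral_rpow hα0 hα1 hθ hD (by linarith : 0 ≤ p + 1)).2 ?_
  simp_rw [fun k => h.integral_scaledSurvival_rpow_add_one hα0 hα1 hθ k hp]
  exact (h.tendsto_integral_rpow hα0 hα1 hθ hD hp).2.mul (tendsto_momentRatio hα0 hα1 θ p)

end

/-! ### Identification of the moments by log-convexity -/

/-- Moments are log-convex functions of the order. -/
theorem integral_rpow_le_mul {Ω : Type*} [MeasurableSpace Ω] {P : Measure Ω} {D : Ω → ℝ}
    (hD : Measurable D) (hD0 : ∀ ω, 0 ≤ D ω) {a b x y : ℝ} (ha : 0 < a) (hb : 0 < b)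
    (hab : a + b = 1) (hx : 0 ≤ x) (hy : 0 ≤ y)
    (hix : Integrable (fun ω => D ω ^ x) P) (hiy : Integrable (fun ω => D ω ^ y) P) :
    ∫ ω, D ω ^ (a * x + b * y) ∂P ≤ (∫ ω, D ω ^ x ∂P) ^ a * (∫ ω, D ω ^ y ∂P) ^ b := by
  have key : ∀ {c z : ℝ}, 0 < c → ∀ ω, (D ω ^ (c * z)) ^ (1 / c) = D ω ^ z := fun {c z} hc ω => by
    rw [← Real.rpow_mul (hD0 ω), mul_comm c z, mul_assoc, mul_one_div_cancel hc.ne', mul_one]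
  have hmem : ∀ {c z : ℝ}, 0 < c → Integrable (fun ω => D ω ^ z) P →
      MemLp (fun ω => D ω ^ (c * z)) (ENNReal.ofReal (1 / c)) P := fun {c z} hc hi => by
    have hc' : 0 < 1 / c := by positivity
    rw [← integrable_norm_rpow_iff (hD.pow_const _).aestronglyMeasurable (by simpa using hc)
      ENNReal.ofReal_ne_top, ENNReal.toReal_ofReal hc'.le]
    refine hi.congr (Eventually.of_forall fun ω => ?_)
    simp only [Real.norm_of_nonneg (Real.rpow_nonneg (hD0 ω) _)]
    exact (key hc ω).symm
  have := integral_mul_le_Lp_mul_Lq_of_nonneg (Real.holderConjugate_one_div ha hb hab)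
    (Eventually.of_forall fun ω => Real.rpow_nonneg (hD0 ω) (a * x))
    (Eventually.of_forall fun ω => Real.rpow_nonneg (hD0 ω) (b * y)) (hmem ha hix) (hmem hb hiy)
  simp_rw [key ha, key hb, one_div_one_div] at this
  refine le_of_eq_of_le (integral_congr_ae (Eventually.of_forall fun ω => ?_)) this
  exact Real.rpow_add_of_nonneg (hD0 ω) (by positivity) (by positivity)

section

variable {α θ : ℝ}

theorem diversityMoment_pos (hα0 : 0 < α) (hα1 : α < 1) (hθ : -α < θ) {p : ℝ} (hp : 0 ≤ p) :
    0 < diversityMoment α θ p := by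
  have h0 : -1 < θ / α := by rw [lt_div_iff₀ hα0]; linarith
  have h1 := Real.Gamma_pos_of_pos (show 0 < θ + 1 by linarith)
  have h2 := Real.Gamma_pos_of_pos (show 0 < θ / α + 1 by linarith)
  have h3 := Real.Gamma_pos_of_pos (show 0 < p + θ / α + 1 by linarith)
  have h4 := Real.Gamma_pos_of_pos (show 0 < p * α + θ + 1 by nlinarith)
  unfold diversityMoment
  positivity

theorem momentRatio_pos (hα0 : 0 < α) (hα1 : α < 1) (hθ : -α < θ) {p : ℝ} (hp : 0 ≤ p) :
    0 < momentRatio α θ p := by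
  have h1 := Real.Gamma_pos_of_pos (show 0 < p * α + θ + 1 by nlinarith)
  have h2 := Real.Gamma_pos_of_pos (show 0 < p * α + θ + α by nlinarith)
  unfold momentRatio
  positivity

theorem diversityMoment_zero (hα0 : 0 < α) (hα1 : α < 1) (hθ : -α < θ) :
    diversityMoment α θ 0 = 1 := by
  have h0 : -1 < θ / α := by rw [lt_div_iff₀ hα0]; linarith
  have h1 := Real.Gamma_pos_of_pos (show 0 < θ + 1 by linarith)
  have h2 := Real.Gamma_pos_of_pos (show 0 < θ / α + 1 by linarith)
  simp only [diversityMoment, zero_add, zero_mul]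
  generalize Real.Gamma (θ + 1) = x at *
  generalize Real.Gamma (θ / α + 1) = y at *
  field_simp

theorem diversityMoment_add_one (hα0 : 0 < α) (hα1 : α < 1) (hθ : -α < θ) {p : ℝ} (hp : 0 ≤ p) :
    diversityMoment α θ (p + 1) = diversityMoment α θ p * momentRatio α θ p := by
  have h0 : -1 < θ / α := by rw [lt_div_iff₀ hα0]; linarith
  have h1 : 0 < p * α + θ + α := by nlinarith
  have h2 := Real.Gamma_pos_of_pos h1
  have h4 := Real.Gamma_pos_of_pos (show 0 < p * α + θ + 1 by linarith)
  simp only [diversityMoment, momentRatio]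
  rw [show p + 1 + θ / α + 1 = (p + θ / α + 1) + 1 by ring,
    show (p + 1) * α + θ + 1 = (p * α + θ + α) + 1 by ring,
    Real.Gamma_add_one (s := p + θ / α + 1) (by linarith), Real.Gamma_add_one h1.ne']
  have h5 : p * α + θ + α = (p + θ / α + 1) * α := by field_simp
  have h6 : p + θ / α + 1 ≠ 0 := by linarith
  generalize Real.Gamma (p * α + θ + α) = x at *
  generalize Real.Gamma (p * α + θ + 1) = y at *
  generalize Real.Gamma (p + θ / α + 1) = z at *
  rw [h5]
  generalize p + θ / α + 1 = w at *
  field_simp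

theorem tendsto_momentRatio_add_div_rpow (hα0 : 0 < α) (hα1 : α < 1) (s : ℝ) :
    Tendsto (fun n : ℕ => momentRatio α θ (n + s) / (n : ℝ) ^ (1 - α)) atTop
      (𝓝 (α ^ (-α))) := by
  have h := ((tendsto_Gamma_mul_add_div_rpow (sub_nonneg.2 hα1.le) (by linarith : 1 - α ≤ 1) hα0
    (s * α + θ + α)).comp tendsto_natCast_atTop_atTop).const_mul α⁻¹
  rw [← Real.rpow_neg_one, ← Real.rpow_add hα0, show -1 + (1 - α) = -α by ring] at h
  refine h.congr fun n => ?_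
  simp only [Function.comp, momentRatio, Real.rpow_neg_one]
  rw [show α * n + (s * α + θ + α) + (1 - α) = (n + s) * α + θ + 1 by ring,
    show α * n + (s * α + θ + α) = (n + s) * α + θ + α by ring, ← div_div, ← div_div]
  ring

/-- The numerator Gamma grows by `n^s` and the denominator by `(α n)^(sα)`; their quotient is
`(α^(-α) n^(1-α))^s`. -/
theorem tendsto_diversityMoment_add_div (hα0 : 0 < α) (hα1 : α < 1) (hθ : -α < θ) {s : ℝ}
    (hs0 : 0 ≤ s) (hs1 : s ≤ 1) :
    Tendsto (fun n : ℕ => diversityMoment α θ (n + s) /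
      (diversityMoment α θ n * ((n : ℝ) ^ (1 - α)) ^ s)) atTop (𝓝 ((α ^ (-α)) ^ s)) := by
  have h1 := (tendsto_Gamma_mul_add_div_rpow hs0 hs1 one_pos (θ / α + 1)).comp
    (tendsto_natCast_atTop_atTop (R := ℝ))
  have h2 := (tendsto_Gamma_mul_add_div_rpow (a := s * α) (by positivity) (by nlinarith) hα0
    (θ + 1)).comp (tendsto_natCast_atTop_atTop (R := ℝ))
  have h3 := h1.div h2 (Real.rpow_pos_of_pos hα0 _).ne'
  have hlim : (1 : ℝ) ^ s / α ^ (s * α) = (α ^ (-α)) ^ s := by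
    rw [Real.one_rpow, one_div, ← Real.rpow_neg hα0.le, ← Real.rpow_mul hα0.le, neg_mul,
      mul_comm s]
  rw [hlim] at h3
  refine h3.congr' ?_
  filter_upwards [eventually_gt_atTop 0] with n hn
  have hn' : (0 : ℝ) < n := by exact_mod_cast hn
  have h0 : -1 < θ / α := by rw [lt_div_iff₀ hα0]; linarith
  have hsplit : (n : ℝ) ^ s = ((n : ℝ) ^ (1 - α)) ^ s * (n : ℝ) ^ (s * α) := by
    rw [← Real.rpow_mul hn'.le, ← Real.rpow_add hn']
    ring_nf
  have g1 := Real.Gamma_pos_of_pos (show 0 < θ + 1 by linarith)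
  have g2 := Real.Gamma_pos_of_pos (show 0 < θ / α + 1 by linarith)
  have g3 := Real.Gamma_pos_of_pos (show 0 < n + s + θ / α + 1 by linarith)
  have g4 := Real.Gamma_pos_of_pos (show 0 < (n + s) * α + θ + 1 by
    have := mul_nonneg (add_nonneg hn'.le hs0) hα0.le
    linarith)
  have g5 := Real.Gamma_pos_of_pos (show 0 < n + θ / α + 1 by linarith)
  have g6 := Real.Gamma_pos_of_pos (show 0 < n * α + θ + 1 by
    have := mul_nonneg hn'.le hα0.le
    linarith)
  have g7 := Real.rpow_pos_of_pos hn' (s * α)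
  have g8 := Real.rpow_pos_of_pos (Real.rpow_pos_of_pos hn' (1 - α)) s
  simp only [Pi.div_apply, Function.comp, diversityMoment, one_mul]
  rw [hsplit, show n + (θ / α + 1) + s = n + s + θ / α + 1 by ring, ← add_assoc (n : ℝ),
    show α * n + (θ + 1) + s * α = (n + s) * α + θ + 1 by ring,
    show α * n + (θ + 1) = n * α + θ + 1 by ring]
  generalize Real.Gamma (n + s + θ / α + 1) = x3 at *
  generalize Real.Gamma ((n + s) * α + θ + 1) = x4 at *
  generalize Real.Gamma (n + θ / α + 1) = x5 at *
  generalize Real.Gamma (n * α + θ + 1) = x6 at *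
  generalize ((n : ℝ) ^ (1 - α)) ^ s = x8 at *
  generalize (n : ℝ) ^ (s * α) = x7 at *
  generalize Real.Gamma (θ + 1) = x1 at *
  generalize Real.Gamma (θ / α + 1) = x2 at *
  field_simp

/-- A log-convex solution of the functional equation of the moments of the `α`-diversity is
determined by its value at `0`. -/
theorem eq_diversityMoment_of_logConvex (hα0 : 0 < α) (hα1 : α < 1) (hθ : -α < θ) {F : ℝ → ℝ}
    (hF0 : F 0 = 1) (hFn : ∀ p, 0 ≤ p → 0 ≤ F p)
    (hF : ∀ p, 0 ≤ p → F (p + 1) = F p * momentRatio α θ p)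
    (hconv : ∀ a b x y : ℝ, 0 < a → 0 < b → a + b = 1 → 0 ≤ x → 0 ≤ y →
      F (a * x + b * y) ≤ F x ^ a * F y ^ b) {p : ℝ} (hp : 0 ≤ p) :
    F p = diversityMoment α θ p := by
  have hG : ∀ {p : ℝ}, 0 ≤ p → 0 < diversityMoment α θ p := fun hp =>
    diversityMoment_pos hα0 hα1 hθ hp
  have hr : ∀ {p : ℝ}, 0 ≤ p → 0 < momentRatio α θ p := fun hp => momentRatio_pos hα0 hα1 hθ hp
  -- Both functions satisfy the same recursion, so their quotient has period `1`. It remains to show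
  -- that it is `1` on `(0, 1)`, which is read off from its behaviour at `n + s` for large `n`.
  have hshift : ∀ {s : ℝ}, 0 ≤ s → ∀ n : ℕ,
      F (n + s) / diversityMoment α θ (n + s) = F s / diversityMoment α θ s := by
    intro s hs n
    induction n with
    | zero => simp
    | succ n ih =>
      have hns : 0 ≤ (n : ℝ) + s := by positivity
      have := hr hns
      push_cast
      rw [add_right_comm, hF _ hns, diversityMoment_add_one hα0 hα1 hθ hns,
        mul_div_mul_right _ _ this.ne', ih]
  have hnat : ∀ n : ℕ, F n = diversityMoment α θ n := by
    intro n
    have := hshift le_rfl n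
    rw [add_zero, hF0, diversityMoment_zero hα0 hα1 hθ, div_one,
      div_eq_one_iff_eq (hG (Nat.cast_nonneg n)).ne'] at this
    exact this
  have hfrac : ∀ s : ℝ, 0 < s → s < 1 → F s / diversityMoment α θ s = 1 := by
    intro s hs0 hs1
    have hc : (0 : ℝ) < α ^ (-α) := Real.rpow_pos_of_pos hα0 _
    have hl := tendsto_diversityMoment_add_div hα0 hα1 hθ hs0.le hs1.le
    have hr0 := tendsto_momentRatio_add_div_rpow (θ := θ) hα0 hα1 0
    have hrs := tendsto_momentRatio_add_div_rpow (θ := θ) hα0 hα1 s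
    simp only [add_zero] at hr0
    apply le_antisymm
    · have hup := (hr0.rpow_const (p := s) (Or.inr hs0.le)).div hl
        (Real.rpow_pos_of_pos hc _).ne'
      rw [div_self (Real.rpow_pos_of_pos hc _).ne'] at hup
      refine ge_of_tendsto hup ?_
      filter_upwards [eventually_gt_atTop 0] with n hn
      have hn' : (0 : ℝ) < n := by exact_mod_cast hn
      have hN : (0 : ℝ) < (n : ℝ) ^ (1 - α) := Real.rpow_pos_of_pos hn' _
      have hrn := hr hn'.le
      have hGn := hG hn'.le
      -- Upper bound: `n + s` lies between the integers `n` and `n + 1`, where `F` is known.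
      have h1 := hconv (1 - s) s n (n + 1) (by linarith) hs0 (by ring) hn'.le (by positivity)
      rw [show (1 - s) * n + s * (n + 1) = n + s by ring, hF n hn'.le, hnat,
        Real.mul_rpow hGn.le hrn.le, ← mul_assoc, ← Real.rpow_add hGn, sub_add_cancel,
        Real.rpow_one] at h1
      simp only [Pi.div_apply]
      rw [← hshift hs0.le n, Real.div_rpow hrn.le hN.le]
      have hGs := hG (show 0 ≤ (n : ℝ) + s by positivity)
      have hNs := Real.rpow_pos_of_pos hN s
      rw [div_div_eq_mul_div, div_mul_eq_mul_div, div_div, div_le_div_iff₀ hGs (by positivity)]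
      have h2 := mul_le_mul_of_nonneg_right h1
        (show 0 ≤ ((n : ℝ) ^ (1 - α)) ^ s * diversityMoment α θ (n + s) by positivity)
      linarith
    · have hlow := hr0.div ((hrs.rpow_const (p := 1 - s) (Or.inr (by linarith))).mul hl)
        (mul_pos (Real.rpow_pos_of_pos hc _) (Real.rpow_pos_of_pos hc _)).ne'
      rw [← Real.rpow_add hc, sub_add_cancel, Real.rpow_one, div_self hc.ne'] at hlow
      refine le_of_tendsto hlow ?_
      filter_upwards [eventually_gt_atTop 0] with n hn
      have hn' : (0 : ℝ) < n := by exact_mod_cast hn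
      have hns : 0 ≤ (n : ℝ) + s := by positivity
      have hN : (0 : ℝ) < (n : ℝ) ^ (1 - α) := Real.rpow_pos_of_pos hn' _
      have hrn := hr hn'.le
      have hrns := hr hns
      have hGn := hG hn'.le
      have hGs := hG hns
      -- Lower bound: the integer `n + 1` lies between `n + s` and `n + s + 1`, and the recursion
      -- expresses both values of `F` through `F (n + s)`.
      have h1 := hconv (1 - s) s (n + s + 1) (n + s) (by linarith) hs0 (by ring) (by positivity) hns
      rw [show (1 - s) * (n + s + 1) + s * (n + s) = (n : ℝ) + 1 by ring, hF n hn'.le, hnat,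
        hF _ hns] at h1
      rw [Real.mul_rpow (hFn _ hns) hrns.le, mul_right_comm,
        ← Real.rpow_add_of_nonneg (hFn _ hns) (by linarith) hs0.le, sub_add_cancel,
        Real.rpow_one] at h1
      simp only [Pi.div_apply]
      rw [← hshift hs0.le n, Real.div_rpow hrns.le hN.le]
      have hNs := Real.rpow_pos_of_pos hN s
      have hNs' := Real.rpow_pos_of_pos hN (1 - s)
      have hrs' := Real.rpow_pos_of_pos hrns (1 - s)
      have hNN : ((n : ℝ) ^ (1 - α)) ^ (1 - s) * ((n : ℝ) ^ (1 - α)) ^ s = (n : ℝ) ^ (1 - α) := by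
        rw [← Real.rpow_add hN, sub_add_cancel, Real.rpow_one]
      rw [div_mul_div_comm, mul_left_comm _ (diversityMoment α θ n), hNN, div_div_div_eq,
        div_le_div_iff₀ (by positivity) hGs]
      have h2 := mul_le_mul_of_nonneg_right h1
        (show 0 ≤ (n : ℝ) ^ (1 - α) * diversityMoment α θ (n + s) by positivity)
      linarith
  have hfl := hshift (Int.fract_nonneg p) ⌊p⌋₊
  have hdec : ((⌊p⌋₊ : ℕ) : ℝ) + Int.fract p = p := by
    rw [natCast_floor_eq_intCast_floor hp, Int.floor_add_fract]
  rw [hdec] at hfl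
  have h1 : F (Int.fract p) / diversityMoment α θ (Int.fract p) = 1 := by
    rcases (Int.fract_nonneg p).eq_or_lt with h | h
    · rw [← h, hF0, diversityMoment_zero hα0 hα1 hθ, div_one]
    · exact hfrac _ h (Int.fract_lt_one p)
  rw [h1, div_eq_one_iff_eq (hG hp).ne'] at hfl
  exact hfl

end

/-! ### Moment determinacy -/

section

variable {μ : Measure ℝ} {m : ℕ → ℝ}

/-- The power series of `cosh` has only even, hence nonnegative, terms, so it can be integrated
termwise; the result is a subseries of the moment series. -/
theorem integrable_cosh_mul (hμ : ∀ n : ℕ, Integrable (fun x : ℝ => x ^ n) μ ∧ ∫ x, x ^ n ∂μ = m n)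
    (hsum : ∀ t : ℝ, Summable fun n : ℕ => t ^ n * m n / (n.factorial : ℝ)) (t : ℝ) :
    Integrable (fun x => Real.cosh (t * x)) μ := by
  refine ⟨(Real.continuous_cosh.comp (continuous_const_mul t)).aestronglyMeasurable, ?_⟩
  have hterm : ∀ x : ℝ, ‖Real.cosh (t * x)‖ₑ =
      ∑' n : ℕ, ENNReal.ofReal ((t * x) ^ (2 * n) / ((2 * n).factorial : ℝ)) := fun x => by
    have h := Real.hasSum_cosh (t * x)
    rw [Real.enorm_eq_ofReal (Real.cosh_pos _).le, ← h.tsum_eq,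
      ENNReal.ofReal_tsum_of_nonneg (fun n => div_nonneg ((even_two_mul n).pow_nonneg _)
        (Nat.cast_nonneg _)) h.summable]
  rw [HasFiniteIntegral]
  simp_rw [hterm]
  rw [lintegral_tsum fun n => by fun_prop]
  have hint : ∀ n : ℕ, ∫⁻ x, ENNReal.ofReal ((t * x) ^ (2 * n) / ((2 * n).factorial : ℝ)) ∂μ =
      ENNReal.ofReal (t ^ (2 * n) * m (2 * n) / ((2 * n).factorial : ℝ)) := fun n => by
    rw [← ofReal_integral_eq_lintegral_ofReal]
    · simp_rw [mul_pow]
      rw [integral_div, integral_const_mul, (hμ _).2]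
    · simp_rw [mul_pow]
      exact ((hμ _).1.const_mul _).div_const _
    · exact Eventually.of_forall fun x =>
        div_nonneg ((even_two_mul n).pow_nonneg _) (Nat.cast_nonneg _)
  simp_rw [hint]
  have hs : Summable fun n : ℕ => t ^ (2 * n) * m (2 * n) / ((2 * n).factorial : ℝ) :=
    (hsum t).comp_injective (mul_right_injective₀ (two_ne_zero (α := ℕ)))
  rw [← ENNReal.ofReal_tsum_of_nonneg _ hs]
  · exact ENNReal.ofReal_lt_top
  · intro n
    rw [← (hμ _).2]
    exact div_nonneg (mul_nonneg ((even_two_mul n).pow_nonneg _)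
      (integral_nonneg fun x => (even_two_mul n).pow_nonneg _)) (Nat.cast_nonneg _)

/-- The exponential series is integrated termwise; its terms are dominated by those of `exp |t x|`,
which is at most `2 cosh (t x)`. -/
theorem hasSum_charFun (hμ : ∀ n : ℕ, Integrable (fun x : ℝ => x ^ n) μ ∧ ∫ x, x ^ n ∂μ = m n)
    (hsum : ∀ t : ℝ, Summable fun n : ℕ => t ^ n * m n / (n.factorial : ℝ)) (t : ℝ) :
    HasSum (fun n : ℕ => (t * Complex.I) ^ n / (n.factorial : ℂ) * (m n : ℂ)) (charFun μ t) := by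
  have hbound : ∀ x : ℝ, HasSum (fun n : ℕ => |t * x| ^ n / (n.factorial : ℝ))
      (Real.exp |t * x|) := fun x => by
    rw [Real.exp_eq_exp_ℝ]; exact NormedSpace.expSeries_div_hasSum_exp _
  have key := hasSum_integral_of_dominated_convergence (μ := μ)
    (F := fun (n : ℕ) (x : ℝ) => (t * x * Complex.I) ^ n / (n.factorial : ℂ))
    (f := fun x : ℝ => Complex.exp (t * x * Complex.I))
    (fun n x => |t * x| ^ n / (n.factorial : ℝ))
    (fun n => Continuous.aestronglyMeasurable (by fun_prop))
    (fun n => Eventually.of_forall fun x => by simp [abs_mul])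
    (Eventually.of_forall fun x => (hbound x).summable) ?_
    (Eventually.of_forall fun x => by
      rw [Complex.exp_eq_exp_ℂ]; exact NormedSpace.expSeries_div_hasSum_exp _)
  · rw [charFun_apply_real]
    have hterm : ∀ n : ℕ, ∫ x : ℝ, (t * x * Complex.I) ^ n / (n.factorial : ℂ) ∂μ =
        (t * Complex.I) ^ n / (n.factorial : ℂ) * (m n : ℂ) := fun n => by
      have hpow : ∀ x : ℝ, (t * x * Complex.I) ^ n / (n.factorial : ℂ) =
          (t * Complex.I) ^ n / (n.factorial : ℂ) * ((x ^ n : ℝ) : ℂ) := fun x => by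
        push_cast; ring
      simp_rw [hpow]
      rw [integral_const_mul, integral_complex_ofReal, (hμ n).2]
    simpa only [hterm] using key
  · refine ((integrable_cosh_mul hμ hsum t).const_mul 2).mono'
      (by simp_rw [(hbound _).tsum_eq]; exact Continuous.aestronglyMeasurable (by fun_prop))
      (Eventually.of_forall fun x => ?_)
    rw [(hbound x).tsum_eq, Real.norm_of_nonneg (Real.exp_pos _).le, ← Real.cosh_abs (t * x),
      Real.cosh_eq]
    linarith [Real.exp_pos (-|t * x|)]

/-- Moment determinacy under a growth condition on the moments. -/
theorem eq_of_moments_eq {ν : Measure ℝ} [IsProbabilityMeasure μ] [IsProbabilityMeasure ν]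
    (hμ : ∀ n : ℕ, Integrable (fun x : ℝ => x ^ n) μ ∧ ∫ x, x ^ n ∂μ = m n)
    (hν : ∀ n : ℕ, Integrable (fun x : ℝ => x ^ n) ν ∧ ∫ x, x ^ n ∂ν = m n)
    (hsum : ∀ t : ℝ, Summable fun n : ℕ => t ^ n * m n / (n.factorial : ℝ)) : μ = ν :=
  Measure.ext_of_charFun <| funext fun t =>
    (hasSum_charFun hμ hsum t).unique (hasSum_charFun hν hsum t)

end

section

variable {α θ : ℝ}

/-- Ratio test: consecutive terms have ratio `t * momentRatio α θ n / (n + 1)`, of order `n^(-α)`.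
-/
theorem summable_diversityMoment (hα0 : 0 < α) (hα1 : α < 1) (hθ : -α < θ) (t : ℝ) :
    Summable fun n : ℕ => t ^ n * diversityMoment α θ n / (n.factorial : ℝ) := by
  rcases eq_or_ne t 0 with rfl | ht
  · refine summable_of_ne_finset_zero (s := {0}) fun n hn => ?_
    rw [zero_pow (by simpa using hn)]; simp
  have hG : ∀ n : ℕ, diversityMoment α θ n ≠ 0 := fun n =>
    (diversityMoment_pos hα0 hα1 hθ (Nat.cast_nonneg n)).ne'
  refine summable_of_ratio_test_tendsto_lt_one (l := 0) one_pos
    (Eventually.of_forall fun n => by have := hG n; positivity) ?_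
  have h1 := tendsto_momentRatio_add_div_rpow (θ := θ) hα0 hα1 0
  have h2 : Tendsto (fun n : ℕ => ((n : ℝ)) ^ (-α)) atTop (𝓝 0) :=
    (tendsto_rpow_neg_atTop hα0).comp tendsto_natCast_atTop_atTop
  have h3 := (((h1.mul h2).mul (tendsto_natCast_div_add_atTop (1 : ℝ))).const_mul t).norm
  simp only [mul_zero, zero_mul, norm_zero] at h3
  refine h3.congr' ?_
  filter_upwards [eventually_gt_atTop 0] with n hn
  have hn' : (0 : ℝ) < n := by exact_mod_cast hn
  have hsplit : (n : ℝ) ^ (1 - α) = n * (n : ℝ) ^ (-α) := by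
    rw [sub_eq_add_neg, Real.rpow_add hn', Real.rpow_one]
  have h4 := Real.rpow_pos_of_pos hn' (-α)
  have h5 := hG n
  have h6 : (n.factorial : ℝ) ≠ 0 := by positivity
  rw [← norm_div]
  congr 1
  rw [Nat.factorial_succ, hsplit]
  push_cast
  rw [diversityMoment_add_one hα0 hα1 hθ hn'.le, add_zero, pow_succ]
  field_simp

end

/-! ### Moments and positivity of the limit -/

section

variable {Ω : Type*} [MeasurableSpace Ω] {P : Measure Ω} {α θ : ℝ} {H : ℕ → Ω → ℝ}

theorem IsBetaHazard.integral_limit_rpow [IsProbabilityMeasure P]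
    (h : IsBetaHazard α θ P H) (hα0 : 0 < α) (hα1 : α < 1) (hθ : -α < θ) {D : Ω → ℝ}
    (hDm : Measurable D) (hD0 : ∀ ω, 0 ≤ D ω)
    (hD : ∀ᵐ ω ∂P, Tendsto (fun k => scaledSurvival α H k ω) atTop (𝓝 (D ω)))
    {p : ℝ} (hp : 0 ≤ p) :
    ∫ ω, D ω ^ p ∂P = diversityMoment α θ p := by
  refine eq_diversityMoment_of_logConvex (F := fun p => ∫ ω, D ω ^ p ∂P) hα0 hα1 hθ (by simp)
    (fun p _ => integral_nonneg fun ω => Real.rpow_nonneg (hD0 ω) p)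
    (fun p hp => h.integral_limit_rpow_add_one hα0 hα1 hθ hD hp) ?_ hp
  intro a b x y ha hb hab hx hy
  exact integral_rpow_le_mul hDm hD0 ha hb hab hx hy
    (h.tendsto_integral_rpow hα0 hα1 hθ hD hx).1 (h.tendsto_integral_rpow hα0 hα1 hθ hD hy).1

/-- As `p ↓ 0`, `D^p` tends to the indicator of `D > 0`, dominated by `1 + D`, so `E D^p → P(D >
0)`; but the moment formula is continuous at `0` with value `1`. -/
theorem IsBetaHazard.ae_limit_pos [IsProbabilityMeasure P]
    (h : IsBetaHazard α θ P H) (hα0 : 0 < α) (hα1 : α < 1) (hθ : -α < θ) {D : Ω → ℝ}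
    (hDm : Measurable D) (hD0 : ∀ ω, 0 ≤ D ω)
    (hD : ∀ᵐ ω ∂P, Tendsto (fun k => scaledSurvival α H k ω) atTop (𝓝 (D ω))) :
    ∀ᵐ ω ∂P, 0 < D ω := by
  have hmeas : MeasurableSet {ω | 0 < D ω} := measurableSet_lt measurable_const hDm
  have hn := tendsto_one_div_add_atTop_nhds_zero_nat (𝕜 := ℝ)
  have hpos : ∀ n : ℕ, (0 : ℝ) < 1 / (n + 1) := fun n => by positivity
  have h1 : Tendsto (fun n : ℕ => ∫ ω, D ω ^ (1 / ((n : ℝ) + 1)) ∂P) atTop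
      (𝓝 (∫ ω, {ω | 0 < D ω}.indicator (fun _ => (1 : ℝ)) ω ∂P)) := by
    have hi := (h.tendsto_integral_rpow hα0 hα1 hθ hD zero_le_one).1
    simp_rw [Real.rpow_one] at hi
    refine tendsto_integral_of_dominated_convergence (fun ω => 1 + D ω)
      (fun n => (hDm.pow_const _).aestronglyMeasurable) ((integrable_const 1).add hi)
      (fun n => Eventually.of_forall fun ω => ?_) (Eventually.of_forall fun ω => ?_)
    · rw [Real.norm_of_nonneg (Real.rpow_nonneg (hD0 ω) _)]
      rcases le_total (D ω) 1 with hle | hle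
      · exact (Real.rpow_le_one (hD0 ω) hle (hpos n).le).trans (by linarith [hD0 ω])
      · have := Real.rpow_le_rpow_of_exponent_le hle
          (show 1 / ((n : ℝ) + 1) ≤ 1 by
            rw [div_le_one (by positivity)]; linarith [Nat.cast_nonneg (α := ℝ) n])
        rw [Real.rpow_one] at this
        linarith
    · rcases (hD0 ω).eq_or_lt with h0 | h0
      · rw [Set.indicator_of_notMem (by simp [← h0])]
        refine tendsto_const_nhds.congr fun n => ?_
        rw [← h0, Real.zero_rpow (hpos n).ne']
      · rw [Set.indicator_of_mem (by exact h0)]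
        simpa [Function.comp_def] using
          (Real.continuousAt_const_rpow h0.ne').tendsto.comp hn
  have h2 : Tendsto (fun n : ℕ => diversityMoment α θ (1 / ((n : ℝ) + 1))) atTop (𝓝 1) := by
    have h0 : -1 < θ / α := by rw [lt_div_iff₀ hα0]; linarith
    have hΓ : ∀ {x : ℝ}, 0 < x → ContinuousAt Real.Gamma x := fun {x} hx =>
      (Real.differentiableAt_Gamma fun m hm => by
        linarith [Nat.cast_nonneg (α := ℝ) m]).continuousAt
    have c1 : ContinuousAt (fun p : ℝ => Real.Gamma (p + θ / α + 1)) 0 :=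
      ContinuousAt.comp (f := fun p : ℝ => p + θ / α + 1) (hΓ (by linarith)) (by fun_prop)
    have c2 : ContinuousAt (fun p : ℝ => Real.Gamma (p * α + θ + 1)) 0 :=
      ContinuousAt.comp (f := fun p : ℝ => p * α + θ + 1) (hΓ (by linarith)) (by fun_prop)
    have hc : ContinuousAt (diversityMoment α θ) 0 :=
      continuousAt_const.mul (c1.div c2 (Real.Gamma_pos_of_pos (by linarith)).ne')
    have := hc.tendsto.comp hn
    rwa [diversityMoment_zero hα0 hα1 hθ] at this
  have h3 : ∀ n : ℕ, ∫ ω, D ω ^ (1 / ((n : ℝ) + 1)) ∂P = diversityMoment α θ (1 / ((n : ℝ) + 1)) :=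
    fun n => h.integral_limit_rpow hα0 hα1 hθ hDm hD0 hD (hpos n).le
  simp_rw [h3] at h1
  have h4 := tendsto_nhds_unique h1 h2
  rw [integral_indicator_const _ hmeas, smul_eq_mul, mul_one] at h4
  have h5 : P {ω | 0 < D ω} = 1 := by
    rw [← ENNReal.toReal_eq_one_iff]; exact h4
  exact (prob_compl_eq_zero_iff hmeas).2 h5

end

/-! ### The sample maximum -/

theorem tendsto_mul_floor_rpow {α x : ℝ} (hα0 : 0 < α) (hα1 : α < 1) (hx : 0 < x) :
    Tendsto (fun n : ℕ => (n : ℝ) * (⌊x * (n : ℝ) ^ (α / (1 - α))⌋₊ : ℝ) ^ (-((1 - α) / α)))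
      atTop (𝓝 (x ^ (-((1 - α) / α)))) := by
  have hβ : 0 < α / (1 - α) := div_pos hα0 (by linarith)
  have h1 := ((tendsto_nat_floor_mul_div_atTop hx.le).comp
    ((tendsto_rpow_atTop hβ).comp tendsto_natCast_atTop_atTop)).rpow_const
    (p := -((1 - α) / α)) (Or.inl hx.ne')
  refine h1.congr' ?_
  filter_upwards [eventually_gt_atTop 0] with n hn
  have hn' : (0 : ℝ) < n := by exact_mod_cast hn
  have h1α : 1 - α ≠ 0 := by linarith
  simp only [Function.comp]
  rw [Real.div_rpow (Nat.cast_nonneg _) (by positivity), ← Real.rpow_mul hn'.le,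
    show α / (1 - α) * -((1 - α) / α) = -1 by field_simp, Real.rpow_neg_one, div_inv_eq_mul,
    mul_comm]

section

variable {Ω : Type*} {α θ : ℝ} {H : ℕ → Ω → ℝ}

/-- The case `k = 0` is a true exception: there the right-hand side is `0` and the survival
probability is `1`. -/
theorem survival_eq_of_pos (hα0 : 0 < α) {k : ℕ} (hk : 0 < k) (ω : Ω) :
    survival H k ω = α * (k : ℝ) ^ (-((1 - α) / α)) * scaledSurvival α H k ω ^ (1 / α) := by
  have hk' : (0 : ℝ) < k := by exact_mod_cast hk
  rw [scaledSurvival_rpow hα0, one_div_mul_cancel hα0.ne', Real.rpow_one,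
    Real.mul_rpow (by positivity) (by positivity), ← Real.rpow_mul hα0.le, ← Real.rpow_mul hk'.le,
    show -α * (1 / α) = -1 by field_simp, Real.rpow_neg_one, mul_one_div, Real.rpow_neg hk'.le]
  have := Real.rpow_pos_of_pos hk' ((1 - α) / α)
  field_simp

theorem tendsto_one_sub_survival_pow (hα0 : 0 < α) (hα1 : α < 1) {x : ℝ} (hx : 0 < x) {ω : Ω}
    {d : ℝ} (hd : Tendsto (fun k => scaledSurvival α H k ω) atTop (𝓝 d)) :
    Tendsto (fun n : ℕ => (1 - survival H ⌊x * (n : ℝ) ^ (α / (1 - α))⌋₊ ω) ^ n) atTop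
      (𝓝 (Real.exp (-α * d ^ (1 / α) * x ^ (-((1 - α) / α))))) := by
  have hβ : 0 < α / (1 - α) := div_pos hα0 (by linarith)
  have hk : Tendsto (fun n : ℕ => ⌊x * (n : ℝ) ^ (α / (1 - α))⌋₊) atTop atTop :=
    tendsto_nat_floor_atTop.comp
      (((tendsto_rpow_atTop hβ).comp tendsto_natCast_atTop_atTop).const_mul_atTop hx)
  suffices hlim : Tendsto
      (fun n : ℕ => (n : ℝ) * -survival H ⌊x * (n : ℝ) ^ (α / (1 - α))⌋₊ ω) atTop
      (𝓝 (-α * d ^ (1 / α) * x ^ (-((1 - α) / α)))) from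
    (Real.tendsto_one_add_pow_exp_of_tendsto hlim).congr fun n => by rw [← sub_eq_add_neg]
  have h1 := (((hd.comp hk).rpow_const (p := 1 / α) (Or.inr (by positivity))).mul
    (tendsto_mul_floor_rpow hα0 hα1 hx)).const_mul (-α)
  rw [← mul_assoc] at h1
  refine h1.congr' ?_
  filter_upwards [hk.eventually_gt_atTop 0] with n hn
  rw [survival_eq_of_pos hα0 hn]
  simp only [Function.comp]
  ring

end

section

variable {Ω : Type*} [MeasurableSpace Ω] {P : Measure Ω} {α θ : ℝ} {H : ℕ → Ω → ℝ}

theorem IsExchangeableSample.isBetaHazard {X : ℕ → Ω → ℕ}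
    (h : IsExchangeableSample α θ P H X) : IsBetaHazard α θ P H :=
  ⟨h.measurable_hazard, h.indep_hazard, h.law_hazard⟩

/-- The maximum is an integer, so `y` may be replaced by its floor; the conditional probability
given the cut points is then the `n`-th power of one cut point, and its expectation is taken. -/
theorem IsExchangeableSample.measureReal_sampleMax_le [IsProbabilityMeasure P] {X : ℕ → Ω → ℕ}
    (h : IsExchangeableSample α θ P H X) (n : ℕ) {y : ℝ} (hy : 0 ≤ y) :
    P.real {ω | (sampleMax X n ω : ℝ) ≤ y} = ∫ ω, (1 - survival H ⌊y⌋₊ ω) ^ n ∂P := by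
  have hcut : ∀ k, Measurable (cutPoint H k) := fun k =>
    (Finset.measurable_fun_prod _ fun i _ => (h.measurable_hazard i).const_sub 1).const_sub 1
  have hle : cutPointSigma H ≤ ‹MeasurableSpace Ω› :=
    (measurable_pi_lambda _ hcut).comap_le
  have hset : {ω | (sampleMax X n ω : ℝ) ≤ y} = {ω | ∀ j ∈ Finset.range n, X j ω ≤ ⌊y⌋₊} := by
    ext ω
    simp only [Set.mem_ofPred_eq, ← Nat.le_floor_iff hy, sampleMax, Finset.sup_le_iff]
  have hmeas : MeasurableSet {ω | ∀ j ∈ Finset.range n, X j ω ≤ ⌊y⌋₊} := by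
    have : {ω | ∀ j ∈ Finset.range n, X j ω ≤ ⌊y⌋₊} =
        ⋂ j ∈ Finset.range n, {ω | X j ω ≤ ⌊y⌋₊} := by ext; simp
    rw [this]
    exact Finset.measurableSet_biInter _ fun j _ =>
      measurableSet_le (h.measurable_sample j) measurable_const
  rw [hset, ← mul_one (P.real _), ← smul_eq_mul, ← integral_indicator_const _ hmeas,
    ← integral_condExp hle]
  refine integral_congr_ae ?_
  filter_upwards [h.cond_iid (Finset.range n) fun _ => ⌊y⌋₊, h.isBetaHazard.ae_survival]
    with ω h1 h2
  rw [h1, Finset.prod_const, Finset.card_range, (h2 _).2.2]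

theorem IsExchangeableSample.tendsto_sampleMax [IsProbabilityMeasure P] {X : ℕ → Ω → ℕ}
    (h : IsExchangeableSample α θ P H X) (hα0 : 0 < α) (hα1 : α < 1) {D : Ω → ℝ}
    (hD : ∀ᵐ ω ∂P, Tendsto (fun k => scaledSurvival α H k ω) atTop (𝓝 (D ω)))
    {x : ℝ} (hx : 0 < x) :
    Tendsto (fun n : ℕ => P.real {ω | (sampleMax X n ω : ℝ) ≤ x * (n : ℝ) ^ (α / (1 - α))}) atTop
      (𝓝 (∫ ω, Real.exp (-α * D ω ^ (1 / α) * x ^ (-((1 - α) / α))) ∂P)) := by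
  simp_rw [fun n : ℕ => h.measureReal_sampleMax_le n
    (show 0 ≤ x * (n : ℝ) ^ (α / (1 - α)) by positivity)]
  refine tendsto_integral_of_dominated_convergence (fun _ => 1)
    (fun n => (((h.isBetaHazard.measurable_survival _).const_sub 1).pow_const n).aestronglyMeasurable)
    (integrable_const 1) (fun n => ?_) ?_
  · filter_upwards [h.isBetaHazard.ae_survival] with ω hω
    obtain ⟨h1, h2, -⟩ := hω ⌊x * (n : ℝ) ^ (α / (1 - α))⌋₊
    rw [Real.norm_of_nonneg (pow_nonneg (by linarith) n)]
    exact pow_le_one₀ (by linarith) (by linarith)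
  · filter_upwards [hD] with ω hω
    exact tendsto_one_sub_survival_pow hα0 hα1 hx hω

/-- The law of the almost sure limit of the rescaled survival probabilities. -/
theorem IsBetaHazard.moments_map_limit [IsProbabilityMeasure P]
    (h : IsBetaHazard α θ P H) (hα0 : 0 < α) (hα1 : α < 1) (hθ : -α < θ) {D : Ω → ℝ}
    (hDm : Measurable D) (hD0 : ∀ ω, 0 ≤ D ω)
    (hD : ∀ᵐ ω ∂P, Tendsto (fun k => scaledSurvival α H k ω) atTop (𝓝 (D ω)))
    {p : ℝ} (hp : 0 ≤ p) :
    Integrable (fun d : ℝ => d ^ p) (P.map D) ∧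
      ∫ d, d ^ p ∂(P.map D) = diversityMoment α θ p := by
  have hm : Measurable fun d : ℝ => d ^ p := by fun_prop
  refine ⟨(integrable_map_measure hm.aestronglyMeasurable hDm.aemeasurable).2
    (h.tendsto_integral_rpow hα0 hα1 hθ hD hp).1, ?_⟩
  rw [integral_map hDm.aemeasurable hm.aestronglyMeasurable]
  exact h.integral_limit_rpow hα0 hα1 hθ hDm hD0 hD hp

end

theorem exists_isBetaHazard {α θ : ℝ} (hα0 : 0 < α) (hα1 : α < 1) (hθ : -α < θ) :
    ∃ P : Measure (ℕ → ℝ), IsProbabilityMeasure P ∧ IsBetaHazard α θ P fun i ω => ω i := by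
  have hprob : ∀ i : ℕ, IsProbabilityMeasure (betaMeasure (1 - α) (θ + ((i : ℝ) + 1) * α)) :=
    fun i => isProbabilityMeasureBeta (by linarith) (IsBetaHazard.shape_pos hα0 hθ i)
  refine ⟨Measure.infinitePi fun i : ℕ => betaMeasure (1 - α) (θ + ((i : ℝ) + 1) * α),
    inferInstance, fun i => measurable_pi_apply i, ?_, fun i => ?_⟩
  · exact iIndepFun_infinitePi (X := fun _ x => x) fun _ => measurable_id
  · exact Measure.infinitePi_map_eval _ i

end GEM

end

theorem mainTheorem5 (α θ : ℝ) (hα0 : 0 < α) (hα1 : α < 1) (hθ : -α < θ) :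
    -- the law `ν` of the `α`-diversity: it exists, lives on `(0, ∞)`, has the stated moments
    ∃ ν : Measure ℝ, IsProbabilityMeasure ν ∧ (∀ᵐ d ∂ν, 0 < d) ∧
      (∀ p : ℝ, 0 < p →
        Integrable (fun d : ℝ => d ^ p) ν ∧ ∫ d, d ^ p ∂ν = GEM.diversityMoment α θ p) ∧
      -- and is determined by them (already by those of integer order)
      (∀ ν' : Measure ℝ, IsProbabilityMeasure ν' →
        (∀ m : ℕ, Integrable (fun d : ℝ => d ^ m) ν' ∧
          ∫ d, d ^ m ∂ν' = GEM.diversityMoment α θ (m : ℝ)) → ν' = ν) ∧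
      -- the limit theorem for the sample maximum
      (∀ (Ω : Type*) [MeasurableSpace Ω] (P : Measure Ω) [IsProbabilityMeasure P]
        (H : ℕ → Ω → ℝ) (X : ℕ → Ω → ℕ), GEM.IsExchangeableSample α θ P H X →
        ∀ x : ℝ, 0 < x →
          Tendsto
            (fun n : ℕ =>
              P.real {ω | (GEM.sampleMax X n ω : ℝ) ≤ x * (n : ℝ) ^ (α / (1 - α))})
            atTop
            (𝓝 (∫ d, Real.exp (-α * d ^ (1 / α) * x ^ (-((1 - α) / α))) ∂ν))) := by
  -- The law `ν` is that of the limit on one canonical product space, where no sample is needed.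
  obtain ⟨Q, hQ, hH⟩ := GEM.exists_isBetaHazard hα0 hα1 hθ
  obtain ⟨D, hDm, hD0, hD⟩ := hH.exists_limit hα0 hα1 hθ
  have hmom := fun (m : ℕ) => hH.moments_map_limit hα0 hα1 hθ hDm hD0 hD (Nat.cast_nonneg (α := ℝ) m)
  simp only [Real.rpow_natCast] at hmom
  have hprob : IsProbabilityMeasure (Q.map D) := Measure.isProbabilityMeasure_map hDm.aemeasurable
  have huniq : ∀ ν' : Measure ℝ, IsProbabilityMeasure ν' →
      (∀ m : ℕ, Integrable (fun d : ℝ => d ^ m) ν' ∧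
        ∫ d, d ^ m ∂ν' = GEM.diversityMoment α θ (m : ℝ)) → ν' = Q.map D := fun ν' _ hν' =>
    GEM.eq_of_moments_eq hν' hmom (GEM.summable_diversityMoment hα0 hα1 hθ)
  refine ⟨Q.map D, hprob, ?_,
    fun p hp => hH.moments_map_limit hα0 hα1 hθ hDm hD0 hD hp.le, huniq, ?_⟩
  · exact (ae_map_iff hDm.aemeasurable measurableSet_Ioi).2
      (hH.ae_limit_pos hα0 hα1 hθ hDm hD0 hD)
  · intro Ω _ P _ H X hX x hx
    -- The limit `E` on the given space has the same integer moments, so by uniqueness its law is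
    -- `ν` and the expectation can be computed with `E`.
    obtain ⟨E, hEm, hE0, hE⟩ := hX.isBetaHazard.exists_limit hα0 hα1 hθ
    have hmomE := fun (m : ℕ) =>
      hX.isBetaHazard.moments_map_limit hα0 hα1 hθ hEm hE0 hE (Nat.cast_nonneg (α := ℝ) m)
    simp only [Real.rpow_natCast] at hmomE
    rw [← huniq (P.map E) (Measure.isProbabilityMeasure_map hEm.aemeasurable) hmomE,
      integral_map hEm.aemeasurable (Measurable.aestronglyMeasurable (by fun_prop))]
    exact hX.tendsto_sampleMax hα0 hα1 hE hx
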